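/- Let $L$ be the free Lie ring (free Lie algebra over $\mathbb{Z}$) on $x_1,\dots,x_6$. Commutators are left-normed: $[a,b,c]=[[a,b],c]$, etc. For $i=1,2,3$ put $v_{2i}=x_{2i-1}+x_{2i}$, and let $\mathcal U=\{x_1,x_3,x_5\}$, $\mathcal V=\{v_2,v_4,v_6\}$, $U=\mathbb{Z}\text{-span}\,\mathcal U$, $V=\mathbb{Z}\text{-span}\,\mathcal V$, so that $L$ is the free Lie ring on $U\oplus V$. For $\mathbb{Z}$-submodules $A,B$ of $L$ let $[A,B]$ be the $\mathbb{Z}$-span of all $[a,b]$ with $a\in A$, $b\in B$, and let $L(A)$ be the Lie subring generated by $A$; we say that $A$ freely generates $L(A)$ if $A$ is a free $\mathbb{Z}$-module and $L(A)$ is a free Lie ring on a $\mathbb{Z}$-basis of $A$. Put $$V\wr U=V+[V,U]+[V,U,U]+\cdots,\qquad W=\sum_{a,b\ge 0}[V,U,\underbrace{U,\dots,U}_{a},\underbrace{V,\dots,V}_{b}].$$ Let $$\mathcal J=\{[v_2,x_1],[v_4,x_3],[v_6,x_5],[v_4,v_2]-[v_4,x_1],[v_2,v_4]-[v_2,x_3],[v_4,v_6]-[v_4,x_5],[v_6,x_1],[v_6,x_3],[v_2,x_5]\}$$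 and let $J$ be the ideal of $L$ generated by $\mathcal J$. Let $\psi_2([v_4,x_1])=[v_4,v_2]-[v_4,x_1]$, $\psi_2([v_2,x_3])=[v_2,v_4]-[v_2,x_3]$, $\psi_2([v_4,x_5])=[v_4,v_6]-[v_4,x_5]$, and $\psi_2([v,u])=[v,u]$ for the other six pairs $(v,u)\in\mathcal V\times\mathcal U$. Then: 1. $U$, $V$ and $V\wr U$ freely generate $L(U)$, $L(V)$ and $L(V\wr U)$, respectively, and $L=L(U)\oplus L(V)\oplus J$ as $\mathbb{Z}$-modules. 2. $J$ is a free Lie ring. In fact, there is a Lie ring automorphism $\Psi$ of $L(V\wr U)$ with $\Psi(v)=v$ and $\Psi([v,u,u_3,\dots,u_a])=[\psi_2([v,u]),u_3,\dots,u_a]$ for all $a\ge 2$, $v\in\mathcal V$ and $u,u_3,\dots,u_a\in\mathcal U$; the module $\Psi(W)$ freely generates $L(\Psi(W))$, and $J=L(\Psi(W))$. -/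

import Mathlib

noncomputable section

namespace FreeLieDecomp

section General

variable {R M : Type} [CommRing R] [LieRing M] [LieAlgebra R M]

/-- For submodules `A`, `B` of a Lie algebra, `[A, B]` is the submodule spanned by all `[a, b]`
with `a ∈ A`, `b ∈ B`. -/
def comm (A B : Submodule R M) : Submodule R M :=
  Submodule.span R {z | ∃ a ∈ A, ∃ b ∈ B, z = ⁅a, b⁆}

/-- `commIter A B n` is the left-normed `[A, B, …, B]` with `n` factors `B`. -/
def commIter (A B : Submodule R M) : ℕ → Submodule R M
  | 0 => A
  | n + 1 => comm (commIter A B n) B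

/-- `wreath B A` is `B ≀ A = B + [B, A] + [B, A, A] + ⋯`. -/
def wreath (B A : Submodule R M) : Submodule R M :=
  ⨆ n : ℕ, commIter B A n

/-- `lieGen A` is the Lie subalgebra generated by the submodule `A`. -/
def lieGen (A : Submodule R M) : LieSubalgebra R M :=
  LieSubalgebra.lieSpan R M (A : Set M)

/-- The submodule `A` freely generates the Lie subalgebra `lieGen A`: the module `A` has a basis,
and the canonical homomorphism to `M` from the free Lie algebra on that basis, whose range is
`lieGen A`, is injective. (This does not depend on the basis.) -/
def FreelyGenerates (A : Submodule R M) : Prop :=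
  ∃ (ι : Type) (b : Module.Basis ι R A),
    Function.Injective (FreeLieAlgebra.lift R (fun i => (b i : M)))

variable (R M) in
/-- The Lie algebra `M` over `R` is free. -/
def IsFreeLie : Prop :=
  ∃ X : Type, Nonempty (FreeLieAlgebra R X ≃ₗ⁅R⁆ M)

/-- The left-normed commutator `[m, y₁, …, yₙ]`. -/
def leftNormed (m : M) : List M → M
  | [] => m
  | y :: ys => leftNormed ⁅m, y⁆ ys

theorem leftNormed_mem_wreath {A B : Submodule R M} :
    ∀ (l : List M) (n : ℕ) (m : M), m ∈ commIter B A n → (∀ y ∈ l, y ∈ A) →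
      leftNormed m l ∈ wreath B A
  | [], n, _, hm, _ => (le_iSup (fun k => commIter B A k) n) hm
  | y :: ys, n, m, hm, hl =>
      leftNormed_mem_wreath ys (n + 1) ⁅m, y⁆
        (Submodule.subset_span ⟨m, hm, y, hl y List.mem_cons_self, rfl⟩)
        (fun z hz => hl z (List.mem_cons_of_mem y hz))

end General

/-- The free Lie ring on `x₁, …, x₆`. -/
abbrev L : Type := FreeLieAlgebra ℤ (Fin 6)

/-- `x 0, …, x 5` are the free generators `x₁, …, x₆`. -/
def x (i : Fin 6) : L := FreeLieAlgebra.of ℤ i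

/-- `u 0, u 1, u 2` are `x₁, x₃, x₅`. -/
def u : Fin 3 → L := ![x 0, x 2, x 4]

/-- `v 0, v 1, v 2` are `v₂ = x₁ + x₂`, `v₄ = x₃ + x₄`, `v₆ = x₅ + x₆`. -/
def v : Fin 3 → L := ![x 0 + x 1, x 2 + x 3, x 4 + x 5]

/-- `U` is the `ℤ`-span of `x₁, x₃, x₅`. -/
def U : Submodule ℤ L := Submodule.span ℤ (Set.range u)

/-- `V` is the `ℤ`-span of `v₂, v₄, v₆`. -/
def V : Submodule ℤ L := Submodule.span ℤ (Set.range v)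

/-- The nine elements `[v₂,x₁]`, `[v₄,x₃]`, `[v₆,x₅]`, `[v₄,v₂]-[v₄,x₁]`, `[v₂,v₄]-[v₂,x₃]`,
`[v₄,v₆]-[v₄,x₅]`, `[v₆,x₁]`, `[v₆,x₃]`, `[v₂,x₅]`. -/
def Jset : Set L :=
  {⁅v 0, u 0⁆, ⁅v 1, u 1⁆, ⁅v 2, u 2⁆,
    ⁅v 1, v 0⁆ - ⁅v 1, u 0⁆, ⁅v 0, v 1⁆ - ⁅v 0, u 1⁆, ⁅v 1, v 2⁆ - ⁅v 1, u 2⁆,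
    ⁅v 2, u 0⁆, ⁅v 2, u 1⁆, ⁅v 0, u 2⁆}

/-- The ideal of `L` generated by the nine elements. -/
def J : LieIdeal ℤ L := LieSubmodule.lieSpan ℤ L Jset

/-- `L(V ≀ U)`. -/
abbrev LVU : LieSubalgebra ℤ L := lieGen (wreath V U)

/-- `W` is the sum of all `[V, U, U, …, U, V, …, V]` with `a` further factors `U` and then `b`
factors `V`, for `a, b ≥ 0`. -/
def W : Submodule ℤ L :=
  ⨆ (a : ℕ) (b : ℕ), commIter (commIter (comm V U) U a) V b

/-- `psi2 j i` is the value of `ψ₂` at the basis element `[v j, u i]` of `[V, U]`. -/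
def psi2 : Fin 3 → Fin 3 → L
  | 1, 0 => ⁅v 1, v 0⁆ - ⁅v 1, u 0⁆
  | 0, 1 => ⁅v 0, v 1⁆ - ⁅v 0, u 1⁆
  | 1, 2 => ⁅v 1, v 2⁆ - ⁅v 1, u 2⁆
  | j, i => ⁅v j, u i⁆

/-- The element `[v j, u i₁, …, u iₙ]` (`n ≥ 0`, `l = [i₁, …, iₙ]`) of the natural basis of
`V ≀ U`, as an element of `L(V ≀ U)`. -/
def gen (j : Fin 3) (l : List (Fin 3)) : LVU :=
  ⟨leftNormed (v j) (l.map u), LieSubalgebra.subset_lieSpan <|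
    leftNormed_mem_wreath _ 0 _ (Submodule.subset_span ⟨j, rfl⟩) (by
      intro y hy
      obtain ⟨i, -, rfl⟩ := List.mem_map.1 hy
      exact Submodule.subset_span ⟨i, rfl⟩)⟩

/-- The prescribed image of `gen j l`: `v j` if `l` is empty, and
`[ψ₂([v j, u i]), u i₃, …, u iₐ]` if `l = [i, i₃, …, iₐ]`. -/
def psiGen (j : Fin 3) : List (Fin 3) → L
  | [] => v j
  | i :: l => leftNormed (psi2 j i) (l.map u)

/-- `Ψ` is the automorphism of `L(V ≀ U)` prescribed on the natural basis of `V ≀ U` by `ψ₂`. -/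
def IsPsi (Ψ : LVU ≃ₗ⁅ℤ⁆ LVU) : Prop :=
  ∀ (j : Fin 3) (l : List (Fin 3)), (Ψ (gen j l) : L) = psiGen j l

theorem comm_le_LVU {A : Submodule ℤ L} (B : Submodule ℤ L)
    (h : ∀ a ∈ A, ∀ b ∈ B, ⁅a, b⁆ ∈ LVU) : comm A B ≤ LVU.toSubmodule := by
  refine Submodule.span_le.2 ?_
  rintro _ ⟨a, ha, b, hb, rfl⟩
  exact h a ha b hb

theorem wreath_le_LVU : wreath V U ≤ LVU.toSubmodule :=
  fun _ h => LieSubalgebra.subset_lieSpan h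

theorem commIter_comm (a : ℕ) : commIter (comm V U) U a = commIter V U (a + 1) := by
  induction a with
  | zero => rfl
  | succ n ih => rw [commIter, ih]; rfl

theorem W_le_LVU : W ≤ LVU.toSubmodule := by
  refine iSup_le fun a => iSup_le fun b => ?_
  induction b with
  | zero =>
    rw [commIter, commIter_comm]
    exact (le_iSup (fun k => commIter V U k) (a + 1)).trans wreath_le_LVU
  | succ n ih =>
    refine comm_le_LVU _ fun y hy z hz => LVU.lie_mem (ih hy) ?_
    exact wreath_le_LVU (le_iSup (fun k => commIter V U k) 0 hz)

/-- The image `Ψ(W)`, as a submodule of `L` (recall that `W ⊆ L(V ≀ U)`). -/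
def psiW (Ψ : LVU ≃ₗ⁅ℤ⁆ LVU) : Submodule ℤ L :=
  Submodule.span ℤ {z | ∃ w : LVU, (w : L) ∈ W ∧ z = (Ψ w : L)}

end FreeLieDecomp

end

namespace FreeLieDecomp

/-! ### Free generating families and left-normed commutators. -/

section General

variable {R M N : Type} [CommRing R] [LieRing M] [LieAlgebra R M] [LieRing N] [LieAlgebra R N]
variable {X Y : Type}

/-! The proof is Lazard elimination applied twice, with a change of free generators in between. If
`f` and `g` together are free generators, the algebra they generate is the direct sum of the free
algebra on `g` and the free algebra on all `[f x, g y₁, …, g yₙ]` (`mem_lieSpan_union_iff`,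
`lift_elim_injective`, `disjoint_lieSpan_elim`, the last two resting on `elimination_of`).

Eliminating `u` gives L = L(V ≀ U) ⊕ L(U). The prescribed images under Ψ differ from the natural
generators of L(V ≀ U), up to sign, by elements generated by commutators with fewer factors from U,
so they are again free generators (`free_of_triangular`), and Ψ is an automorphism. It fixes `v`, so
`v` can now be eliminated from the new generators: L(V ≀ U) = L(Ψ(W)) ⊕ L(V).

Finally L(Ψ(W)) is normalized by both `v` and `u` (`normalizer_lieSpan_psi_eq_top`), hence an ideal
of L. It contains the nine generators of J, and its own generators are iterated brackets of these,
so it equals J. -/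

theorem range_lift (f : X → M) :
    (FreeLieAlgebra.lift R f).range = LieSubalgebra.lieSpan R M (Set.range f) := by
  apply le_antisymm
  · let K := LieSubalgebra.lieSpan R M (Set.range f)
    let g : X → K := fun a => ⟨f a, LieSubalgebra.subset_lieSpan ⟨a, rfl⟩⟩
    have h : K.incl.comp (FreeLieAlgebra.lift R g) = FreeLieAlgebra.lift R f := by
      ext a
      simp [g]
    rintro _ ⟨a, rfl⟩
    rw [← h]
    exact (FreeLieAlgebra.lift R g a).2
  · rw [LieSubalgebra.lieSpan_le]
    rintro _ ⟨a, rfl⟩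
    exact ⟨FreeLieAlgebra.of R a, by simp⟩

theorem lieSpan_range_of :
    LieSubalgebra.lieSpan R (FreeLieAlgebra R X) (Set.range (FreeLieAlgebra.of R)) = ⊤ := by
  rw [← range_lift, eq_top_iff]
  intro a _
  have h : FreeLieAlgebra.lift R (FreeLieAlgebra.of R) =
      (LieHom.id : _ →ₗ⁅R⁆ FreeLieAlgebra R X) := by
    ext; simp
  exact ⟨a, by rw [h]; rfl⟩

/-- The generators map to the standard basis of the abelian Lie algebra `X →₀ R`. -/
theorem linearIndependent_of :
    LinearIndependent R (FreeLieAlgebra.of R : X → FreeLieAlgebra R X) := by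
  let : LieRing (X →₀ R) :=
    { bracket := fun _ _ => 0
      add_lie := by intros; simp
      lie_add := by intros; simp
      lie_self := by intros; rfl
      leibniz_lie := by intros; simp }
  let : LieAlgebra R (X →₀ R) := { lie_smul := by intros; exact (smul_zero _).symm }
  let φ : FreeLieAlgebra R X →ₗ⁅R⁆ (X →₀ R) := FreeLieAlgebra.lift R fun a => Finsupp.single a 1
  refine LinearIndependent.of_comp (φ : FreeLieAlgebra R X →ₗ[R] (X →₀ R)) ?_
  have h : ((φ : FreeLieAlgebra R X →ₗ[R] (X →₀ R)) ∘ FreeLieAlgebra.of R) =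
      fun a : X => Finsupp.single a (1 : R) := by
    funext a
    exact FreeLieAlgebra.lift_of_apply _ a
  rw [h]
  exact Finsupp.linearIndependent_single_one R X

theorem linearIndependent_of_lift_injective {f : X → M}
    (hf : Function.Injective (FreeLieAlgebra.lift R f)) : LinearIndependent R f := by
  have h := (linearIndependent_of (R := R) (X := X)).map' (FreeLieAlgebra.lift R f : _ →ₗ[R] M)
    (LinearMap.ker_eq_bot.2 hf)
  have e : (FreeLieAlgebra.lift R f : _ →ₗ[R] M) ∘ FreeLieAlgebra.of R = f :=
    FreeLieAlgebra.of_comp_lift f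
  rwa [e] at h

theorem freelyGenerates_span {f : X → M} (hf : Function.Injective (FreeLieAlgebra.lift R f)) :
    FreelyGenerates (Submodule.span R (Set.range f)) := by
  refine ⟨X, Module.Basis.span (linearIndependent_of_lift_injective hf), ?_⟩
  convert hf using 3
  funext a
  exact congrArg _ (Module.Basis.span_apply _ a)

theorem lieGen_span (s : Set M) : lieGen (Submodule.span R s) = LieSubalgebra.lieSpan R M s := by
  apply le_antisymm
  · exact LieSubalgebra.lieSpan_le.2 LieSubalgebra.submodule_span_le_lieSpan
  · exact LieSubalgebra.lieSpan_mono Submodule.subset_span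

theorem leftNormed_append (m : M) (l l' : List M) :
    leftNormed m (l ++ l') = leftNormed (leftNormed m l) l' := by
  induction l generalizing m with
  | nil => rfl
  | cons y ys ih => exact ih _

theorem leftNormed_append_singleton (m : M) (l : List M) (y : M) :
    leftNormed m (l ++ [y]) = ⁅leftNormed m l, y⁆ := by
  rw [leftNormed_append]
  rfl

theorem map_leftNormed (φ : M →ₗ⁅R⁆ N) (m : M) (l : List M) :
    φ (leftNormed m l) = leftNormed (φ m) (l.map φ) := by
  induction l generalizing m with
  | nil => rfl
  | cons y ys ih => simp [leftNormed, ih]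

/-- The submodule `[B, A, …, A]` is spanned by the left-normed commutators of generators. -/
theorem commIter_span (f : X → M) (g : Y → M) (n : ℕ) :
    commIter (Submodule.span R (Set.range f)) (Submodule.span R (Set.range g)) n =
      Submodule.span R {z | ∃ (a : X) (l : List Y), l.length = n ∧
        z = leftNormed (f a) (l.map g)} := by
  induction n with
  | zero =>
    rw [commIter]
    congr 1
    ext z
    constructor
    · rintro ⟨a, rfl⟩
      exact ⟨a, [], rfl, rfl⟩
    · rintro ⟨a, l, hl, rfl⟩
      rw [List.eq_nil_of_length_eq_zero hl]
      exact ⟨a, rfl⟩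
  | succ n ih =>
    rw [commIter, ih]
    apply le_antisymm
    · refine Submodule.span_le.2 ?_
      rintro _ ⟨a, ha, b, hb, rfl⟩
      rw [SetLike.mem_coe]
      induction ha using Submodule.span_induction with
      | zero => simp
      | add p q _ _ hp hq => rw [add_lie]; exact add_mem hp hq
      | smul r p _ hp => rw [smul_lie]; exact Submodule.smul_mem _ _ hp
      | mem p hp =>
        obtain ⟨c, l, hl, rfl⟩ := hp
        induction hb using Submodule.span_induction with
        | zero => simp
        | add p q _ _ hp hq => rw [lie_add]; exact add_mem hp hq
        | smul r p _ hp => rw [lie_smul]; exact Submodule.smul_mem _ _ hp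
        | mem q hq =>
          obtain ⟨y, rfl⟩ := hq
          refine Submodule.subset_span ⟨c, l ++ [y], by simp [hl], ?_⟩
          rw [List.map_append, List.map_singleton, leftNormed_append_singleton]
    · refine Submodule.span_le.2 ?_
      rintro _ ⟨a, l, hl, rfl⟩
      obtain ⟨l', y, rfl⟩ : ∃ l' y, l = l' ++ [y] := by
        rcases List.eq_nil_or_concat l with h | ⟨l', y, h⟩
        · simp [h] at hl
        · exact ⟨l', y, by simpa using h⟩
      refine Submodule.subset_span ⟨_, Submodule.subset_span ⟨a, l', by simpa using hl, rfl⟩, g y,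
        Submodule.subset_span ⟨y, rfl⟩, ?_⟩
      rw [List.map_append, List.map_singleton, leftNormed_append_singleton]

/-! ### Lazard elimination. -/

/-- The family of the left-normed commutators `[f x, g y₁, …, g yₙ]`. -/
def elim (f : X → M) (g : Y → M) (p : X × List Y) : M :=
  leftNormed (f p.1) (p.2.map g)

theorem iSup_commIter_span (f : X → M) (g : Y → M) :
    ⨆ n, commIter (Submodule.span R (Set.range f)) (Submodule.span R (Set.range g)) n =
      Submodule.span R (Set.range (elim f g)) := by
  simp_rw [commIter_span, ← Submodule.span_iUnion]
  congr 1
  ext z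
  simp only [Set.mem_iUnion, Set.mem_ofPred_eq, Set.mem_range, Prod.exists, elim]
  constructor
  · rintro ⟨_, a, l, _, rfl⟩
    exact ⟨a, l, rfl⟩
  · rintro ⟨a, l, rfl⟩
    exact ⟨_, a, l, rfl, rfl⟩

theorem elim_lie (f : X → M) (g : Y → M) (a : X) (l : List Y) (y : Y) :
    ⁅elim f g (a, l), g y⁆ = elim f g (a, l ++ [y]) := by
  simp [elim, leftNormed_append_singleton]

open LieAlgebra LieModule.Cohomology in
/-- A map from the generators to the free Lie algebra extends to a derivation. -/
theorem exists_derivation (d : X → FreeLieAlgebra R X) :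
    ∃ D : LieDerivation R (FreeLieAlgebra R X) (FreeLieAlgebra R X),
      ∀ a, D (FreeLieAlgebra.of R a) = d a := by
  let F := FreeLieAlgebra R X
  -- The zero cocycle gives the split extension of `F` by the abelian ideal `F`. The second
  -- coordinate of a homomorphism `a ↦ (a, D a)` into it is a derivation.
  let c : twoCocycle R F F := 0
  let φ : F →ₗ⁅R⁆ ofTwoCocycle c :=
    FreeLieAlgebra.lift R fun a => ofProd c (FreeLieAlgebra.of R a, d a)
  let p : ofTwoCocycle c →ₗ⁅R⁆ F :=
    { toFun := fun z => ((ofProd c).symm z).1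
      map_add' := fun _ _ => rfl
      map_smul' := fun _ _ => rfl
      map_lie' := rfl }
  have hp : p.comp φ = LieHom.id := by
    ext a
    exact congrArg p (FreeLieAlgebra.lift_of_apply _ a)
  have hp' (a : F) : ((ofProd c).symm (φ a)).1 = a := LieHom.congr_fun hp a
  refine ⟨{ toFun := fun z => ((ofProd c).symm (φ z)).2
            map_add' := fun a b => by simp
            map_smul' := fun a b => by simp
            leibniz' := fun a b => ?_ }, fun a => ?_⟩
  · change ((ofProd c).symm (φ ⁅a, b⁆)).2 =
      ⁅a, ((ofProd c).symm (φ b)).2⁆ - ⁅b, ((ofProd c).symm (φ a)).2⁆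
    rw [LieHom.map_lie, bracket_ofTwoCocycle]
    simp [c, hp']
  · exact congrArg (fun z => ((ofProd c).symm z).2) (FreeLieAlgebra.lift_of_apply _ a)

/-- Bracketing with `y` is a derivation, so stability need only be tested on generators. -/
theorem mem_normalizer_lieSpan {s : Set M} {y : M}
    (h : ∀ z ∈ s, ⁅z, y⁆ ∈ LieSubalgebra.lieSpan R M s) :
    y ∈ (LieSubalgebra.lieSpan R M s).normalizer := by
  rw [LieSubalgebra.mem_normalizer_iff']
  intro z hz
  induction hz using LieSubalgebra.lieSpan_induction with
  | mem z hz => exact h z hz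
  | zero => simp
  | add a b _ _ ha hb => rw [add_lie]; exact add_mem ha hb
  | smul r a _ ha => rw [smul_lie]; exact LieSubalgebra.smul_mem _ _ ha
  | lie a b ha' hb' ha hb =>
    rw [lie_lie]
    exact sub_mem (LieSubalgebra.lie_mem _ ha' hb) (LieSubalgebra.lie_mem _ hb' ha)

theorem mem_normalizer_elim (f : X → M) (g : Y → M) (y : Y) :
    g y ∈ (LieSubalgebra.lieSpan R M (Set.range (elim f g))).normalizer := by
  refine mem_normalizer_lieSpan ?_
  rintro _ ⟨⟨a, l⟩, rfl⟩
  rw [elim_lie]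
  exact LieSubalgebra.subset_lieSpan ⟨_, rfl⟩

/-- Lazard elimination, generation: the subalgebra generated by `f` and `g` is the sum of those
generated by `elim f g` and by `g`. -/
theorem mem_lieSpan_union_iff (f : X → M) (g : Y → M) (m : M) :
    m ∈ LieSubalgebra.lieSpan R M (Set.range f ∪ Set.range g) ↔
      ∃ a ∈ LieSubalgebra.lieSpan R M (Set.range (elim f g)),
        ∃ b ∈ LieSubalgebra.lieSpan R M (Set.range g), a + b = m := by
  set K := LieSubalgebra.lieSpan R M (Set.range (elim f g)) with hK
  set G := LieSubalgebra.lieSpan R M (Set.range g) with hG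
  have hn : G ≤ K.normalizer := by
    refine LieSubalgebra.lieSpan_le.2 ?_
    rintro _ ⟨y, rfl⟩
    exact mem_normalizer_elim f g y
  constructor
  · intro hm
    induction hm using LieSubalgebra.lieSpan_induction with
    | mem z hz =>
      rcases hz with ⟨a, rfl⟩ | hz
      · exact ⟨f a, LieSubalgebra.subset_lieSpan ⟨(a, []), rfl⟩, 0, zero_mem _, add_zero _⟩
      · exact ⟨0, zero_mem _, z, LieSubalgebra.subset_lieSpan hz, zero_add _⟩
    | zero => exact ⟨0, zero_mem _, 0, zero_mem _, add_zero _⟩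
    | add p q _ _ hp hq =>
      obtain ⟨a, ha, b, hb, rfl⟩ := hp
      obtain ⟨c, hc, d, hd, rfl⟩ := hq
      exact ⟨a + c, add_mem ha hc, b + d, add_mem hb hd, by abel⟩
    | smul r p _ hp =>
      obtain ⟨a, ha, b, hb, rfl⟩ := hp
      exact ⟨r • a, LieSubalgebra.smul_mem _ _ ha, r • b, LieSubalgebra.smul_mem _ _ hb,
        (smul_add _ _ _).symm⟩
    | lie p q _ _ hp hq =>
      obtain ⟨a, ha, b, hb, rfl⟩ := hp
      obtain ⟨c, hc, d, hd, rfl⟩ := hq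
      -- The mixed brackets fall into `K` because `G` normalizes it.
      refine ⟨⁅a, c⁆ + ⁅a, d⁆ + ⁅b, c⁆, add_mem (add_mem (LieSubalgebra.lie_mem _ ha hc) ?_) ?_,
        ⁅b, d⁆, LieSubalgebra.lie_mem _ hb hd, ?_⟩
      · exact (K.mem_normalizer_iff' d).1 (hn hd) a ha
      · exact (K.mem_normalizer_iff b).1 (hn hb) c hc
      · simp only [add_lie, lie_add]
        abel
  · rintro ⟨a, ha, b, hb, rfl⟩
    refine add_mem ?_ (LieSubalgebra.lieSpan_mono Set.subset_union_right hb)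
    revert a
    change K ≤ _
    refine LieSubalgebra.lieSpan_le.2 ?_
    rintro _ ⟨⟨a, l⟩, rfl⟩
    induction l using List.reverseRecOn with
    | nil => exact LieSubalgebra.subset_lieSpan (Or.inl ⟨a, rfl⟩)
    | append_singleton l y ih =>
      rw [← elim_lie]
      exact LieSubalgebra.lie_mem _ ih (LieSubalgebra.subset_lieSpan (Or.inr ⟨y, rfl⟩))

-- Let `Y` act on the free algebra `F` on `X × List Y` by derivations that append a letter to the
-- list. The map `θ` to the semidirect product carries the eliminated generators to those of `F` and
-- `Y` to the other factor; injectivity and directness are then read off in the semidirect product.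
open LieAlgebra in
theorem elimination_of :
    Function.Injective (FreeLieAlgebra.lift R
      (elim (FreeLieAlgebra.of R ∘ Sum.inl : X → FreeLieAlgebra R (X ⊕ Y))
        (FreeLieAlgebra.of R ∘ Sum.inr))) ∧
    ∀ a b, FreeLieAlgebra.lift R
      (elim (FreeLieAlgebra.of R ∘ Sum.inl : X → FreeLieAlgebra R (X ⊕ Y))
        (FreeLieAlgebra.of R ∘ Sum.inr)) a =
      FreeLieAlgebra.lift R (FreeLieAlgebra.of R ∘ Sum.inr) b → a = 0 ∧ b = 0 := by
  let F := FreeLieAlgebra R (X × List Y)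
  have hD (y : Y) := exists_derivation (R := R) (X := X × List Y)
    -- The sign appears because `elim` brackets with `y` on the right, while derivations act from
    -- the left.
    fun p => -FreeLieAlgebra.of R (p.1, p.2 ++ [y])
  choose D hD using hD
  let ρ : FreeLieAlgebra R Y →ₗ⁅R⁆ LieDerivation R F F := FreeLieAlgebra.lift R D
  let θ : FreeLieAlgebra R (X ⊕ Y) →ₗ⁅R⁆ (F ⋊⁅ρ⁆ FreeLieAlgebra R Y) :=
    FreeLieAlgebra.lift R (Sum.elim (fun a => SemiDirectSum.inl ρ (FreeLieAlgebra.of R (a, [])))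
      (fun y => SemiDirectSum.inr ρ (FreeLieAlgebra.of R y)))
  have h1 : θ.comp (FreeLieAlgebra.lift R (elim (FreeLieAlgebra.of R ∘ Sum.inl)
      (FreeLieAlgebra.of R ∘ Sum.inr))) = SemiDirectSum.inl ρ := by
    apply FreeLieAlgebra.hom_ext
    rintro ⟨a, l⟩
    rw [LieHom.comp_apply, FreeLieAlgebra.lift_of_apply]
    induction l using List.reverseRecOn with
    | nil => exact FreeLieAlgebra.lift_of_apply _ _
    | append_singleton l y ih =>
      rw [← elim_lie, LieHom.map_lie, ih]
      have e : θ ((FreeLieAlgebra.of R ∘ Sum.inr) y) =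
        SemiDirectSum.inr ρ (FreeLieAlgebra.of R y) := FreeLieAlgebra.lift_of_apply _ _
      rw [e]
      simp [ρ, hD]
  have h2 : θ.comp (FreeLieAlgebra.lift R (FreeLieAlgebra.of R ∘ Sum.inr)) =
      SemiDirectSum.inr ρ := by
    apply FreeLieAlgebra.hom_ext
    intro y
    rw [LieHom.comp_apply, FreeLieAlgebra.lift_of_apply]
    exact FreeLieAlgebra.lift_of_apply _ _
  constructor
  · intro a b hab
    apply SemiDirectSum.inl_injective ρ
    rw [← h1, LieHom.comp_apply, LieHom.comp_apply, hab]
  · intro a b hab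
    have h : SemiDirectSum.inl ρ a = SemiDirectSum.inr ρ b := by
      rw [← h1, ← h2, LieHom.comp_apply, LieHom.comp_apply, hab]
    simpa [eq_comm] using h

/-- Lazard elimination, freeness. -/
theorem lift_elim_injective {f : X → M} {g : Y → M}
    (h : Function.Injective (FreeLieAlgebra.lift R (Sum.elim f g))) :
    Function.Injective (FreeLieAlgebra.lift R (elim f g)) := by
  have e : FreeLieAlgebra.lift R (elim f g) = (FreeLieAlgebra.lift R (Sum.elim f g)).comp
      (FreeLieAlgebra.lift R (elim (FreeLieAlgebra.of R ∘ Sum.inl)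
        (FreeLieAlgebra.of R ∘ Sum.inr))) := by
    apply FreeLieAlgebra.hom_ext
    intro p
    simp [elim, map_leftNormed, Function.comp_def]
  rw [e, LieHom.coe_comp]
  exact h.comp elimination_of.1

theorem lift_comp_injective {f : X → M} (h : Function.Injective (FreeLieAlgebra.lift R f))
    {s : Y → X} (hs : Function.Injective s) :
    Function.Injective (FreeLieAlgebra.lift R (f ∘ s)) := by
  classical
  -- A retraction that kills the generators outside the range of `s`.
  let r : FreeLieAlgebra R X →ₗ⁅R⁆ FreeLieAlgebra R Y := FreeLieAlgebra.lift R fun a =>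
    if ha : ∃ y, s y = a then FreeLieAlgebra.of R ha.choose else 0
  have hr : r.comp (FreeLieAlgebra.lift R (FreeLieAlgebra.of R ∘ s)) = LieHom.id := by
    apply FreeLieAlgebra.hom_ext
    intro y
    have ha : ∃ z, s z = s y := ⟨y, rfl⟩
    rw [LieHom.comp_apply, FreeLieAlgebra.lift_of_apply, Function.comp_apply,
      FreeLieAlgebra.lift_of_apply, dif_pos ha, hs ha.choose_spec]
    rfl
  have e : FreeLieAlgebra.lift R (f ∘ s) = (FreeLieAlgebra.lift R f).comp
      (FreeLieAlgebra.lift R (FreeLieAlgebra.of R ∘ s)) := by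
    apply FreeLieAlgebra.hom_ext
    intro p
    simp
  rw [e, LieHom.coe_comp]
  exact h.comp (Function.LeftInverse.injective (LieHom.congr_fun hr))

/-- Lazard elimination, directness. -/
theorem disjoint_lieSpan_elim {f : X → M} {g : Y → M}
    (h : Function.Injective (FreeLieAlgebra.lift R (Sum.elim f g))) {m : M}
    (h1 : m ∈ LieSubalgebra.lieSpan R M (Set.range (elim f g)))
    (h2 : m ∈ LieSubalgebra.lieSpan R M (Set.range g)) : m = 0 := by
  rw [← range_lift] at h1 h2
  obtain ⟨a, rfl⟩ := h1
  obtain ⟨b, hb⟩ := h2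
  let φ := FreeLieAlgebra.lift R (Sum.elim f g)
  have e1 : FreeLieAlgebra.lift R (elim f g) = φ.comp
      (FreeLieAlgebra.lift R (elim (FreeLieAlgebra.of R ∘ Sum.inl)
        (FreeLieAlgebra.of R ∘ Sum.inr))) := by
    apply FreeLieAlgebra.hom_ext
    intro p
    simp [φ, elim, map_leftNormed, Function.comp_def]
  have e2 : FreeLieAlgebra.lift R g = φ.comp
      (FreeLieAlgebra.lift R (FreeLieAlgebra.of R ∘ Sum.inr)) := by
    apply FreeLieAlgebra.hom_ext
    intro p
    simp [φ]
  have := (elimination_of (R := R) (X := X) (Y := Y)).2 a b (h ?_)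
  · rw [this.1]
    simp
  · rw [← LieHom.comp_apply, ← LieHom.comp_apply, ← e1, ← e2]
    exact hb.symm

/-! ### Triangular changes of free generators. -/

/-- An endomorphism of a free Lie algebra that is unitriangular, up to signs, with respect to a
grading of the generators is surjective; moreover each generator has a preimage of the same
triangular form. -/
theorem exists_preimage_of_triangular (deg : X → ℕ) (ε : X → ℤˣ)
    (φ : FreeLieAlgebra R X →ₗ⁅R⁆ FreeLieAlgebra R X)
    (hφ : ∀ a, φ (FreeLieAlgebra.of R a) - (ε a : ℤ) • FreeLieAlgebra.of R a ∈
      LieSubalgebra.lieSpan R (FreeLieAlgebra R X) (FreeLieAlgebra.of R '' {b | deg b < deg a}))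
    (a : X) : ∃ z, φ z = FreeLieAlgebra.of R a ∧ z - (ε a : ℤ) • FreeLieAlgebra.of R a ∈
      LieSubalgebra.lieSpan R (FreeLieAlgebra R X)
        (FreeLieAlgebra.of R '' {b | deg b < deg a}) := by
  set S : ℕ → LieSubalgebra R (FreeLieAlgebra R X) := fun n =>
    LieSubalgebra.lieSpan R (FreeLieAlgebra R X) (FreeLieAlgebra.of R '' {b | deg b < n}) with hS
  have hmono {m n : ℕ} (h : m ≤ n) : S m ≤ S n :=
    LieSubalgebra.lieSpan_mono (Set.image_mono fun b hb => lt_of_lt_of_le hb h)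
  have step (a : X) (h : S (deg a) ≤ (S (deg a)).map φ) :
      ∃ z, φ z = FreeLieAlgebra.of R a ∧ z - (ε a : ℤ) • FreeLieAlgebra.of R a ∈ S (deg a) := by
    obtain ⟨s, hs, hs'⟩ := (LieSubalgebra.mem_map _ _ _).1 (h (hφ a))
    have hε : (ε a : ℤ) * ε a = 1 := by
      rw [← Units.val_mul, ← sq, Int.units_sq, Units.val_one]
    refine ⟨(ε a : ℤ) • (FreeLieAlgebra.of R a - s), ?_, ?_⟩
    · rw [map_zsmul, map_sub, hs', sub_sub_cancel, smul_smul, hε, one_smul]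
    · rw [smul_sub, sub_sub_cancel_left]
      exact neg_mem (zsmul_mem hs _)
  have key (n : ℕ) : S n ≤ (S n).map φ := by
    induction n using Nat.strong_induction_on with
    | _ n ih =>
      refine LieSubalgebra.lieSpan_le.2 ?_
      rintro _ ⟨b, hb, rfl⟩
      obtain ⟨z, hz, hz'⟩ := step b (ih _ hb)
      refine (LieSubalgebra.mem_map _ _ _).2 ⟨z, ?_, hz⟩
      have hb' : FreeLieAlgebra.of R b ∈ S n := LieSubalgebra.subset_lieSpan ⟨b, hb, rfl⟩
      rw [← sub_add_cancel z ((ε b : ℤ) • FreeLieAlgebra.of R b)]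
      exact add_mem (hmono (le_of_lt hb) hz') (zsmul_mem hb' _)
  exact step a (key _)

/-- The preimages of the generators define a right inverse `χ` of `φ`. It is triangular with the
same signs, hence itself surjective, and this makes `φ` injective. -/
theorem bijective_of_triangular (deg : X → ℕ) (ε : X → ℤˣ)
    (φ : FreeLieAlgebra R X →ₗ⁅R⁆ FreeLieAlgebra R X)
    (hφ : ∀ a, φ (FreeLieAlgebra.of R a) - (ε a : ℤ) • FreeLieAlgebra.of R a ∈
      LieSubalgebra.lieSpan R (FreeLieAlgebra R X)
        (FreeLieAlgebra.of R '' {b | deg b < deg a})) :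
    Function.Bijective φ := by
  have surj (φ : FreeLieAlgebra R X →ₗ⁅R⁆ FreeLieAlgebra R X)
      (h : ∀ a, ∃ z, φ z = FreeLieAlgebra.of R a) : Function.Surjective φ := by
    rw [← LieHom.range_eq_top, eq_top_iff, ← lieSpan_range_of, LieSubalgebra.lieSpan_le]
    rintro _ ⟨a, rfl⟩
    exact h a
  choose z hz hz' using exists_preimage_of_triangular deg ε φ hφ
  let χ : FreeLieAlgebra R X →ₗ⁅R⁆ FreeLieAlgebra R X := FreeLieAlgebra.lift R z
  have hχ : φ.comp χ = LieHom.id := by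
    apply FreeLieAlgebra.hom_ext
    intro a
    simp [χ, hz]
  have hχs : Function.Surjective χ := surj χ fun a =>
    (exists_preimage_of_triangular deg ε χ (by simpa [χ] using hz') a).imp fun _ h => h.1
  refine And.intro (fun a b hab => ?_) (surj φ fun a => ⟨z a, hz a⟩)
  obtain ⟨a, rfl⟩ := hχs a
  obtain ⟨b, rfl⟩ := hχs b
  rw [← LieHom.comp_apply, ← LieHom.comp_apply, hχ] at hab
  exact congrArg χ hab

/-- A triangular change of a family of free generators yields a family of free generators of the
same subalgebra. -/
theorem free_of_triangular (deg : X → ℕ) {f f' : X → M}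
    (hf : Function.Injective (FreeLieAlgebra.lift R f))
    (h : ∀ a, f' a - f a ∈ LieSubalgebra.lieSpan R M (f '' {b | deg b < deg a}) ∨
      f' a + f a ∈ LieSubalgebra.lieSpan R M (f '' {b | deg b < deg a})) :
    Function.Injective (FreeLieAlgebra.lift R f') ∧
      LieSubalgebra.lieSpan R M (Set.range f') = LieSubalgebra.lieSpan R M (Set.range f) := by
  have hε (a : X) : ∃ ε : ℤˣ, f' a - (ε : ℤ) • f a ∈
      LieSubalgebra.lieSpan R M (f '' {b | deg b < deg a}) := by
    rcases h a with h | h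
    · exact ⟨1, by simpa using h⟩
    · exact ⟨-1, by simpa using h⟩
  choose ε hε using hε
  -- The error terms are pulled back along `lift R f`, which turns the change of family into a
  -- triangular endomorphism of the free algebra.
  have hr (a : X) : ∃ r ∈ LieSubalgebra.lieSpan R (FreeLieAlgebra R X)
      (FreeLieAlgebra.of R '' {b | deg b < deg a}),
      FreeLieAlgebra.lift R f r = f' a - (ε a : ℤ) • f a := by
    rw [← LieSubalgebra.mem_map, LieSubalgebra.map_lieSpan, ← Set.image_comp,
      FreeLieAlgebra.of_comp_lift]
    exact hε a
  choose r hr hr' using hr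
  let φ : FreeLieAlgebra R X →ₗ⁅R⁆ FreeLieAlgebra R X :=
    FreeLieAlgebra.lift R fun a => r a + (ε a : ℤ) • FreeLieAlgebra.of R a
  have hφ : Function.Bijective φ := bijective_of_triangular deg ε φ fun a => by
    simpa [φ] using hr a
  have e : FreeLieAlgebra.lift R f' = (FreeLieAlgebra.lift R f).comp φ := by
    apply FreeLieAlgebra.hom_ext
    intro a
    rw [LieHom.comp_apply, FreeLieAlgebra.lift_of_apply, FreeLieAlgebra.lift_of_apply, map_add,
      map_zsmul, FreeLieAlgebra.lift_of_apply, hr', sub_add_cancel]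
  refine ⟨?_, ?_⟩
  · rw [e, LieHom.coe_comp]
    exact hf.comp hφ.1
  · rw [← range_lift, ← range_lift, e]
    ext m
    rw [LieHom.mem_range, LieHom.mem_range]
    constructor
    · rintro ⟨y, rfl⟩
      exact ⟨φ y, rfl⟩
    · rintro ⟨y, rfl⟩
      obtain ⟨y, rfl⟩ := hφ.2 y
      exact ⟨y, rfl⟩

theorem exists_equiv_of_lift_injective {f : X → M}
    (hf : Function.Injective (FreeLieAlgebra.lift R f)) {K : LieSubalgebra R M}
    (hK : LieSubalgebra.lieSpan R M (Set.range f) = K) :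
    ∃ e : FreeLieAlgebra R X ≃ₗ⁅R⁆ K, ∀ a, (e (FreeLieAlgebra.of R a) : M) = f a := by
  rw [← range_lift] at hK
  subst hK
  exact ⟨LieEquiv.ofInjective _ hf, fun a => by
    rw [LieEquiv.ofInjective_apply, FreeLieAlgebra.lift_of_apply]⟩

theorem leftNormed_sub (a b : M) (l : List M) :
    leftNormed (a - b) l = leftNormed a l - leftNormed b l := by
  induction l generalizing a b with
  | nil => rfl
  | cons y ys ih => simp only [leftNormed, sub_lie, ih]

theorem isInternal_of_forall_exists {A B C : Submodule R M}
    (h : ∀ m, ∃ a ∈ A, ∃ b ∈ B, ∃ c ∈ C, a + b + c = m)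
    (h' : ∀ a ∈ A, ∀ b ∈ B, ∀ c ∈ C, a + b + c = 0 → a = 0 ∧ b = 0 ∧ c = 0) :
    DirectSum.IsInternal (![A, B, C] : Fin 3 → Submodule R M) := by
  classical
  rw [DirectSum.isInternal_submodule_iff_iSupIndep_and_iSup_eq_top]
  constructor
  · rw [iSupIndep_iff_finsetSum_eq_zero_imp_eq_zero]
    intro s w hw hs
    let w' : Fin 3 → M := fun i => if i ∈ s then w i else 0
    have hw' (i : Fin 3) : w' i ∈ (![A, B, C] : Fin 3 → Submodule R M) i := by
      by_cases hi : i ∈ s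
      · simpa [w', hi] using hw i hi
      · simp [w', hi]
    have hs' : ∑ i, w' i = 0 := by simpa [w'] using hs
    rw [Fin.sum_univ_three] at hs'
    obtain ⟨h0, h1, h2⟩ := h' _ (hw' 0) _ (hw' 1) _ (hw' 2) hs'
    have hz : ∀ i, w' i = 0 := by
      intro i
      fin_cases i <;> assumption
    intro i hi
    simpa [w', hi] using hz i
  · rw [eq_top_iff]
    intro m _
    obtain ⟨a, ha, b, hb, c, hc, rfl⟩ := h m
    exact add_mem (add_mem (Submodule.mem_iSup_of_mem (0 : Fin 3) ha)
      (Submodule.mem_iSup_of_mem (1 : Fin 3) hb)) (Submodule.mem_iSup_of_mem (2 : Fin 3) hc)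

end General

/-! ### Passage from the six free generators to `v` and `u`. -/

section ChangeOfGenerators

variable {R : Type} [CommRing R]

open FreeLieAlgebra in
theorem lift_shift_injective : Function.Injective (lift R
    (Sum.elim ![of R (0 : Fin 6) + of R 1, of R 2 + of R 3, of R 4 + of R 5]
      ![of R (0 : Fin 6), of R 2, of R 4])) := by
  let o : Fin 3 ⊕ Fin 3 → FreeLieAlgebra R (Fin 3 ⊕ Fin 3) := of R
  -- The inverse substitution: odd-numbered generators go to the `u`'s, and x₂ᵢ = v₂ᵢ - x₂ᵢ₋₁.
  let r : FreeLieAlgebra R (Fin 6) →ₗ⁅R⁆ FreeLieAlgebra R (Fin 3 ⊕ Fin 3) := lift R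
    ![o (.inr 0), o (.inl 0) - o (.inr 0), o (.inr 1), o (.inl 1) - o (.inr 1), o (.inr 2),
      o (.inl 2) - o (.inr 2)]
  have hr : r.comp (lift R
    (Sum.elim ![of R (0 : Fin 6) + of R 1, of R 2 + of R 3, of R 4 + of R 5]
      ![of R (0 : Fin 6), of R 2, of R 4])) = LieHom.id := by
    apply hom_ext
    rintro (i | i) <;> rw [LieHom.comp_apply, lift_of_apply] <;> fin_cases i <;> simp [r, o]
  exact Function.LeftInverse.injective (LieHom.congr_fun hr)

open FreeLieAlgebra in
theorem lieSpan_shift : LieSubalgebra.lieSpan R (FreeLieAlgebra R (Fin 6))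
    (Set.range ![of R (0 : Fin 6) + of R 1, of R 2 + of R 3, of R 4 + of R 5] ∪
      Set.range ![of R (0 : Fin 6), of R 2, of R 4]) = ⊤ := by
  set v' := ![of R (0 : Fin 6) + of R 1, of R 2 + of R 3, of R 4 + of R 5] with hv'
  set u' := ![of R (0 : Fin 6), of R 2, of R 4] with hu'
  rw [eq_top_iff, ← lieSpan_range_of, LieSubalgebra.lieSpan_le]
  have hu (i : Fin 3) : u' i ∈ LieSubalgebra.lieSpan R _ (Set.range v' ∪ Set.range u') :=
    LieSubalgebra.subset_lieSpan (Or.inr ⟨i, rfl⟩)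
  have hvu (i : Fin 3) : v' i - u' i ∈ LieSubalgebra.lieSpan R _ (Set.range v' ∪ Set.range u') :=
    sub_mem (LieSubalgebra.subset_lieSpan (Or.inl ⟨i, rfl⟩)) (hu i)
  rintro _ ⟨i, rfl⟩
  fin_cases i
  · exact hu 0
  · simpa [v', u'] using hvu 0
  · exact hu 1
  · simpa [v', u'] using hvu 1
  · exact hu 2
  · simpa [v', u'] using hvu 2

end ChangeOfGenerators

/-- L is a Lie algebra over `ℤ` both as a free Lie algebra and as a Lie ring. Identifying the two
structures lets results over a general `R` be specialized. -/
theorem instLieAlgebra_eq :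
    FreeLieAlgebra.instLieAlgebra ℤ (Fin 6) = (LieRing.instLieAlgebra : LieAlgebra ℤ L) := rfl

theorem lift_vu_injective : Function.Injective (FreeLieAlgebra.lift ℤ (Sum.elim v u)) :=
  instLieAlgebra_eq ▸ lift_shift_injective

theorem lieSpan_vu : LieSubalgebra.lieSpan ℤ L (Set.range v ∪ Set.range u) = ⊤ :=
  instLieAlgebra_eq ▸ lieSpan_shift

theorem lift_u_injective : Function.Injective (FreeLieAlgebra.lift ℤ u) := by
  have h := lift_comp_injective lift_vu_injective Sum.inr_injective
  rwa [Sum.elim_comp_inr] at h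

theorem lift_v_injective : Function.Injective (FreeLieAlgebra.lift ℤ v) := by
  have h := lift_comp_injective lift_vu_injective Sum.inl_injective
  rwa [Sum.elim_comp_inl] at h

theorem freelyGenerates_U : FreelyGenerates U :=
  freelyGenerates_span lift_u_injective

theorem freelyGenerates_V : FreelyGenerates V :=
  freelyGenerates_span lift_v_injective

theorem wreath_V_U : wreath V U = Submodule.span ℤ (Set.range (elim v u)) :=
  iSup_commIter_span v u

theorem LVU_eq : LVU = LieSubalgebra.lieSpan ℤ L (Set.range (elim v u)) := by
  rw [LVU, wreath_V_U]
  exact lieGen_span _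

theorem freelyGenerates_wreath : FreelyGenerates (wreath V U) := by
  rw [wreath_V_U]
  exact freelyGenerates_span (lift_elim_injective lift_vu_injective)

/-! ### Filtration by the number of factors from U, and the automorphism Ψ. -/

/-- The subalgebras of `L(V ≀ U)` generated by the basis elements with at most `n - 1` factors
from `U`. -/
noncomputable def filtration (n : ℕ) : LieSubalgebra ℤ L :=
  LieSubalgebra.lieSpan ℤ L (elim v u '' {p | p.2.length < n})

theorem lie_u_mem_filtration {n : ℕ} {z : L} (hz : z ∈ filtration n) (i : Fin 3) :
    ⁅z, u i⁆ ∈ filtration (n + 1) := by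
  have hmono : filtration n ≤ filtration (n + 1) :=
    LieSubalgebra.lieSpan_mono (Set.image_mono fun p hp => Nat.lt_succ_of_lt hp)
  unfold filtration at hz
  induction hz using LieSubalgebra.lieSpan_induction with
  | mem z hz =>
    obtain ⟨⟨j, l⟩, hl, rfl⟩ := hz
    rw [elim_lie]
    refine LieSubalgebra.subset_lieSpan ⟨_, ?_, rfl⟩
    simpa using hl
  | zero => simp
  | add a b _ _ ha hb => rw [add_lie]; exact add_mem ha hb
  | smul r a _ ha => rw [smul_lie]; exact LieSubalgebra.smul_mem _ _ ha
  | lie a b ha' hb' ha hb =>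
    rw [lie_lie]
    exact sub_mem (LieSubalgebra.lie_mem _ (hmono ha') hb)
      (LieSubalgebra.lie_mem _ (hmono hb') ha)

theorem leftNormed_u_mem_filtration (l : List (Fin 3)) {n : ℕ} {z : L} (hz : z ∈ filtration n) :
    leftNormed z (l.map u) ∈ filtration (n + l.length) := by
  induction l generalizing n z with
  | nil => exact hz
  | cons i l ih =>
    rw [List.length_cons, Nat.add_comm l.length, ← Nat.add_assoc]
    exact ih (lie_u_mem_filtration hz i)

/-- The images under `Ψ` of the natural basis of `V ≀ U`. -/
noncomputable def psiFamily (p : Fin 3 × List (Fin 3)) : L := psiGen p.1 p.2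

/-- A modified value of `psi2` is `[v, v'] - [v, u]`. Its second term gives minus the natural
generator. The first has lost one factor from U, so after the remaining brackets it lies in a lower
step of the filtration. -/
theorem psiFamily_triangular (p : Fin 3 × List (Fin 3)) :
    psiFamily p - elim v u p ∈ filtration p.2.length ∨
      psiFamily p + elim v u p ∈ filtration p.2.length := by
  have hv (j k : Fin 3) (l : List (Fin 3)) :
      leftNormed ⁅v j, v k⁆ (l.map u) ∈ filtration (l.length + 1) := by
    rw [Nat.add_comm]
    refine leftNormed_u_mem_filtration l (LieSubalgebra.lie_mem _ ?_ ?_)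
    · exact LieSubalgebra.subset_lieSpan ⟨(j, []), Nat.zero_lt_one, rfl⟩
    · exact LieSubalgebra.subset_lieSpan ⟨(k, []), Nat.zero_lt_one, rfl⟩
  obtain ⟨j, _ | ⟨i, l⟩⟩ := p
  · fin_cases j <;> simp [psiFamily, psiGen, elim, leftNormed]
  · fin_cases j <;> fin_cases i <;>
      simp [psiFamily, psiGen, psi2, elim, leftNormed, leftNormed_sub, hv]

theorem psiFamily_free : Function.Injective (FreeLieAlgebra.lift ℤ psiFamily) ∧
    LieSubalgebra.lieSpan ℤ L (Set.range psiFamily) = LVU := by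
  rw [LVU_eq]
  refine free_of_triangular (f' := psiFamily) (fun p => p.2.length)
    (lift_elim_injective lift_vu_injective) fun p => ?_
  rcases psiFamily_triangular p with h | h
  · exact Or.inl h
  · exact Or.inr h

/-- Two free generating families of the same algebra, with the same index set, are matched. -/
theorem exists_isPsi : ∃ Ψ : LVU ≃ₗ⁅ℤ⁆ LVU, IsPsi Ψ := by
  obtain ⟨e, he⟩ := exists_equiv_of_lift_injective (lift_elim_injective lift_vu_injective)
    LVU_eq.symm
  obtain ⟨e', he'⟩ := exists_equiv_of_lift_injective psiFamily_free.1 psiFamily_free.2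
  refine ⟨e.symm.trans e', fun j l => ?_⟩
  have h : gen j l = e (FreeLieAlgebra.of ℤ (j, l)) := Subtype.ext (he (j, l)).symm
  rw [LieEquiv.trans_apply, h, LieEquiv.symm_apply_apply, he']
  rfl

/-! ### The second elimination and Ψ(W). -/

/-- The images under `Ψ` of the basis elements `[v j, u i, …]` of `V ≀ U` outside `V`. -/
noncomputable def psiTail (p : Fin 3 × Fin 3 × List (Fin 3)) : L := psiGen p.1 (p.2.1 :: p.2.2)

theorem lift_psiTail_v_injective :
    Function.Injective (FreeLieAlgebra.lift ℤ (Sum.elim psiTail v)) := by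
  -- The index set splits into nonempty and empty lists.
  let s : (Fin 3 × Fin 3 × List (Fin 3)) ⊕ Fin 3 → Fin 3 × List (Fin 3) :=
    Sum.elim (fun p => (p.1, p.2.1 :: p.2.2)) (fun j => (j, []))
  have hs : Function.Injective s := by
    rintro (⟨j, i, l⟩ | j) (⟨j', i', l'⟩ | j') h <;> simp_all [s]
  have e : psiFamily ∘ s = Sum.elim psiTail v := by
    funext p
    rcases p with p | p <;> rfl
  rw [← e]
  exact lift_comp_injective psiFamily_free.1 hs

theorem lieSpan_psiTail_v :
    LieSubalgebra.lieSpan ℤ L (Set.range psiTail ∪ Set.range v) = LVU := by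
  rw [← psiFamily_free.2]
  congr 1
  ext z
  constructor
  · rintro (⟨p, rfl⟩ | ⟨j, rfl⟩)
    · exact ⟨(p.1, p.2.1 :: p.2.2), rfl⟩
    · exact ⟨(j, []), rfl⟩
  · rintro ⟨⟨j, _ | ⟨i, l⟩⟩, rfl⟩
    · exact Or.inr ⟨j, rfl⟩
    · exact Or.inl ⟨(j, i, l), rfl⟩

theorem W_eq : W = Submodule.span ℤ (Set.range
    (elim (fun p : Fin 3 × Fin 3 × List (Fin 3) => elim v u (p.1, p.2.1 :: p.2.2)) v)) := by
  have h (a : ℕ) : commIter (comm V U) U a = Submodule.span ℤ (Set.range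
      fun p : {p : Fin 3 × Fin 3 × List (Fin 3) // p.2.2.length = a} =>
        elim v u (p.1.1, p.1.2.1 :: p.1.2.2)) := by
    rw [commIter_comm, V, U, commIter_span]
    congr 1
    ext z
    constructor
    · rintro ⟨j, _ | ⟨i, l⟩, hl, rfl⟩
      · simp at hl
      · exact ⟨⟨(j, i, l), by simpa using hl⟩, rfl⟩
    · rintro ⟨⟨⟨j, i, l⟩, hl⟩, rfl⟩
      exact ⟨j, i :: l, by simpa using hl, rfl⟩
  simp_rw [W, h, V, iSup_commIter_span, ← Submodule.span_iUnion]
  congr 1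
  ext z
  simp only [Set.mem_iUnion, Set.mem_range]
  constructor
  · rintro ⟨a, ⟨p, l⟩, rfl⟩
    exact ⟨(p.1, l), rfl⟩
  · rintro ⟨⟨p, l⟩, rfl⟩
    exact ⟨_, (⟨p, rfl⟩, l), rfl⟩

/-- Since Ψ fixes each `v j`, trailing factors from V are carried along unchanged. -/
theorem psiW_eq {Ψ : LVU ≃ₗ⁅ℤ⁆ LVU} (hΨ : IsPsi Ψ) :
    psiW Ψ = Submodule.span ℤ (Set.range (elim psiTail v)) := by
  have key (p : (Fin 3 × Fin 3 × List (Fin 3)) × List (Fin 3)) : ∃ w : LVU,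
      (w : L) = elim (fun p : Fin 3 × Fin 3 × List (Fin 3) => elim v u (p.1, p.2.1 :: p.2.2)) v p ∧
      (Ψ w : L) = elim psiTail v p := by
    obtain ⟨⟨j, i, l⟩, l'⟩ := p
    refine ⟨leftNormed (gen j (i :: l)) (l'.map fun k => gen k []), ?_, ?_⟩
    · rw [← LieSubalgebra.coe_incl, map_leftNormed, List.map_map]
      rfl
    · rw [← LieSubalgebra.coe_incl, ← LieEquiv.coe_toLieHom, map_leftNormed, map_leftNormed,
        List.map_map, List.map_map]
      have h1 : LVU.incl (Ψ.toLieHom (gen j (i :: l))) = psiTail (j, i, l) := hΨ _ _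
      have h2 : (⇑LVU.incl ∘ ⇑Ψ.toLieHom) ∘ (fun k => gen k []) = v := funext fun k => hΨ k []
      rw [h1]
      exact congrArg (fun g => leftNormed _ (l'.map g)) h2
  apply le_antisymm
  · refine Submodule.span_le.2 ?_
    rintro _ ⟨w, hw, rfl⟩
    -- Ψ acts only on `LVU`, whereas `W` lies in L; `T` is the preimage of the span under Ψ, viewed
    -- inside L.
    let T : Submodule ℤ L := ((Submodule.span ℤ (Set.range (elim psiTail v))).comap
      ((LVU.incl : LVU →ₗ[ℤ] L) ∘ₗ (Ψ.toLieHom : LVU →ₗ[ℤ] LVU))).map (LVU.incl : LVU →ₗ[ℤ] L)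
    have hT : W ≤ T := by
      rw [W_eq]
      refine Submodule.span_le.2 ?_
      rintro _ ⟨p, rfl⟩
      obtain ⟨w, hw, hw'⟩ := key p
      refine ⟨w, ?_, hw⟩
      change (Ψ w : L) ∈ Submodule.span ℤ (Set.range (elim psiTail v))
      rw [hw']
      exact Submodule.subset_span ⟨p, rfl⟩
    obtain ⟨w', h1, h2⟩ := hT hw
    have h3 : w' = w := Subtype.ext h2
    subst h3
    exact h1
  · refine Submodule.span_le.2 ?_
    rintro _ ⟨p, rfl⟩
    obtain ⟨w, hw, hw'⟩ := key p
    refine Submodule.subset_span ⟨w, ?_, hw'.symm⟩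
    rw [W_eq, hw]
    exact Submodule.subset_span ⟨p, rfl⟩

/-! ### Identification of J and the direct decomposition. -/

theorem psi2_mem_Jset (j i : Fin 3) : psi2 j i ∈ Jset := by
  fin_cases j <;> fin_cases i <;> simp [psi2, Jset]

theorem Jset_subset_range : Jset ⊆ Set.range fun p : Fin 3 × Fin 3 => psi2 p.1 p.2 := by
  intro z hz
  simp only [Jset, Set.mem_insert_iff, Set.mem_singleton_iff] at hz
  rcases hz with rfl | rfl | rfl | rfl | rfl | rfl | rfl | rfl | rfl
  exacts [⟨(0, 0), rfl⟩, ⟨(1, 1), rfl⟩, ⟨(2, 2), rfl⟩, ⟨(1, 0), rfl⟩, ⟨(0, 1), rfl⟩,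
    ⟨(1, 2), rfl⟩, ⟨(2, 0), rfl⟩, ⟨(2, 1), rfl⟩, ⟨(0, 2), rfl⟩]

theorem leftNormed_mem_lieIdeal {R M : Type} [CommRing R] [LieRing M] [LieAlgebra R M]
    (I : LieIdeal R M) {m : M} (hm : m ∈ I) (l : List M) : leftNormed m l ∈ I := by
  induction l generalizing m with
  | nil => exact hm
  | cons y ys ih => exact ih (lie_mem_left R M I m y hm)

/-- L is generated by `v` and `u`, and for `v` the claim is built into `elim`. Bracketing a
`psiTail` element with `u k` gives another one. Trailing factors `v y` are handled by the Jacobi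
identity, since `[v y, u k]` lies in `LVU`, which normalizes `N`. -/
theorem normalizer_lieSpan_psi_eq_top :
    (LieSubalgebra.lieSpan ℤ L (Set.range (elim psiTail v))).normalizer = ⊤ := by
  set N := LieSubalgebra.lieSpan ℤ L (Set.range (elim psiTail v)) with hN
  have hv (j : Fin 3) : v j ∈ N.normalizer := mem_normalizer_elim psiTail v j
  have hK : LVU ≤ N.normalizer := by
    rw [← lieSpan_psiTail_v, LieSubalgebra.lieSpan_le]
    rintro _ (⟨p, rfl⟩ | ⟨j, rfl⟩)
    · exact N.le_normalizer (LieSubalgebra.subset_lieSpan ⟨(p, []), rfl⟩)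
    · exact hv j
  rw [eq_top_iff, ← lieSpan_vu, LieSubalgebra.lieSpan_le]
  rintro _ (⟨j, rfl⟩ | ⟨k, rfl⟩)
  · exact hv j
  · refine mem_normalizer_lieSpan ?_
    rintro _ ⟨⟨⟨j, i, l⟩, l'⟩, rfl⟩
    induction l' using List.reverseRecOn with
    | nil =>
      refine LieSubalgebra.subset_lieSpan ⟨((j, i, l ++ [k]), []), ?_⟩
      simp [elim, leftNormed, psiTail, psiGen, leftNormed_append_singleton]
    | append_singleton l' y ih =>
      rw [← elim_lie, lie_lie]
      refine sub_mem ?_ ?_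
      · refine (N.mem_normalizer_iff' _).1 (hK ?_) _ (LieSubalgebra.subset_lieSpan ⟨_, rfl⟩)
        rw [LVU_eq]
        exact LieSubalgebra.subset_lieSpan ⟨(y, [k]), rfl⟩
      · exact (N.mem_normalizer_iff _).1 (hv y) _ ih

/-- Being normalized by all of L, the subalgebra `N` is an ideal, and the nine generators of J are
its generators with both lists empty. -/
theorem J_eq : J.toSubmodule =
    (LieSubalgebra.lieSpan ℤ L (Set.range (elim psiTail v))).toSubmodule := by
  set N := LieSubalgebra.lieSpan ℤ L (Set.range (elim psiTail v)) with hN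
  apply le_antisymm
  · let I : LieIdeal ℤ L :=
      { N.toSubmodule with
        lie_mem := fun {a m} hm => (N.mem_normalizer_iff a).1
          (by rw [normalizer_lieSpan_psi_eq_top]; exact LieSubalgebra.mem_top a) m hm }
    have hJ : J ≤ I := by
      refine LieSubmodule.lieSpan_le.2 fun z hz => ?_
      obtain ⟨⟨j, i⟩, rfl⟩ := Jset_subset_range hz
      exact LieSubalgebra.subset_lieSpan (s := Set.range (elim psiTail v)) ⟨((j, i, []), []), rfl⟩
    exact hJ
  · have h : N ≤ LieIdeal.toLieSubalgebra ℤ L J := by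
      refine LieSubalgebra.lieSpan_le.2 ?_
      rintro _ ⟨⟨⟨j, i, l⟩, l'⟩, rfl⟩
      exact leftNormed_mem_lieIdeal J (leftNormed_mem_lieIdeal J
        (LieSubmodule.subset_lieSpan (psi2_mem_Jset j i)) _) _
    exact h

theorem isInternal_U_V_J : DirectSum.IsInternal
    (![(lieGen U).toSubmodule, (lieGen V).toSubmodule, J.toSubmodule] :
      Fin 3 → Submodule ℤ L) := by
  rw [J_eq, U, V, lieGen_span, lieGen_span]
  apply isInternal_of_forall_exists
  · intro m
    have hm : m ∈ LieSubalgebra.lieSpan ℤ L (Set.range v ∪ Set.range u) := by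
      rw [lieSpan_vu]
      exact LieSubalgebra.mem_top m
    obtain ⟨k, hk, a, ha, rfl⟩ := (mem_lieSpan_union_iff v u m).1 hm
    rw [← LVU_eq, ← lieSpan_psiTail_v] at hk
    obtain ⟨c, hc, b, hb, rfl⟩ := (mem_lieSpan_union_iff psiTail v k).1 hk
    exact ⟨a, ha, b, hb, c, hc, by abel⟩
  · intro a ha b hb c hc h
    have hk : c + b ∈ LieSubalgebra.lieSpan ℤ L (Set.range (elim v u)) := by
      rw [← LVU_eq, ← lieSpan_psiTail_v]
      exact (mem_lieSpan_union_iff psiTail v _).2 ⟨c, hc, b, hb, rfl⟩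
    have ha' : a = -(c + b) := by
      rw [eq_neg_iff_add_eq_zero, ← h]
      abel
    -- The first elimination separates L(U) from L(V ≀ U); the second then separates L(V) from J.
    have ha0 : a = 0 := disjoint_lieSpan_elim lift_vu_injective (ha' ▸ neg_mem hk) ha
    have hb' : b = -c := by
      rw [eq_neg_iff_add_eq_zero, ← h, ha0, zero_add]
    have hb0 : b = 0 := disjoint_lieSpan_elim lift_psiTail_v_injective (hb' ▸ neg_mem hc) hb
    refine ⟨ha0, hb0, ?_⟩
    rw [← h, ha0, hb0]
    abel

theorem isFreeLie_J : IsFreeLie ℤ J := by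
  have h : LieSubalgebra.lieSpan ℤ L (Set.range (elim psiTail v)) =
      LieIdeal.toLieSubalgebra ℤ L J :=
    LieSubalgebra.toSubmodule_injective J_eq.symm
  obtain ⟨e, -⟩ := exists_equiv_of_lift_injective
    (lift_elim_injective lift_psiTail_v_injective) h
  exact ⟨_, ⟨e⟩⟩

end FreeLieDecomp

open FreeLieDecomp in
theorem mainTheorem3 :
    -- `U`, `V` and `V ≀ U` freely generate the Lie subrings `L(U)`, `L(V)`, `L(V ≀ U)`
    (FreelyGenerates U ∧ FreelyGenerates V ∧ FreelyGenerates (wreath V U)) ∧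
    -- `L = L(U) ⊕ L(V) ⊕ J` as `ℤ`-modules
    DirectSum.IsInternal
      (![(lieGen U).toSubmodule, (lieGen V).toSubmodule, J.toSubmodule] :
        Fin 3 → Submodule ℤ L) ∧
    -- `J` is a free Lie ring
    IsFreeLie ℤ J ∧
    -- `J = L(Ψ(W))`, the free Lie ring on `Ψ(W)`
    ∃ Ψ : LVU ≃ₗ⁅ℤ⁆ LVU, IsPsi Ψ ∧ FreelyGenerates (psiW Ψ) ∧
      J.toSubmodule = (lieGen (psiW Ψ)).toSubmodule := by
  refine ⟨⟨freelyGenerates_U, freelyGenerates_V, freelyGenerates_wreath⟩, isInternal_U_V_J,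
    isFreeLie_J, ?_⟩
  obtain ⟨Ψ, hΨ⟩ := exists_isPsi
  refine ⟨Ψ, hΨ, ?_, ?_⟩
  · rw [psiW_eq hΨ]
    exact freelyGenerates_span (lift_elim_injective lift_psiTail_v_injective)
  · rw [psiW_eq hΨ, lieGen_span, J_eq]
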